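/- Let $n\ge 1$, $\sigma>0$, and let $K\subseteq\mathbb R^n$ be nonempty, closed and convex (possibly unbounded). Observe $Y=\mu+\xi$ with $\mu\in K$ and $\xi\sim N(0,\sigma^2 I_n)$, let $\hat\mu(Y)=\operatorname{argmin}_{\nu\in K}\|Y-\nu\|^2$ be the least squares estimator, where $\|\cdot\|$ is the Euclidean norm, and let $$\varepsilon_K=\Big(\sup_{\mu\in K}\mathbb E\|\hat\mu(Y)-\mu\|^2\Big)^{1/2}$$ be its worst case rate. For a constant $c^*>1$ and $\varepsilon\ge 0$ let $$M^{\mathrm{loc}}(\varepsilon)=\sup_{\theta\in K}M\big(\varepsilon/c^*,\,B(\theta,\varepsilon)\cap K\big),$$ where $B(\theta,\varepsilon)$ is the closed Euclidean ball and $M(\eta,T)$ is the largest cardinality of a set of points of $T$ at pairwise distances $>\eta$. Let $$\varepsilon^*=\sup\{\varepsilon\ge 0:\ \varepsilon^2/\sigma^2\le\log M^{\mathrm{loc}}(\varepsilon)\},\qquad C_n=4C\big(1+\log_{c^*}\sqrt{2\pi n}\big)^{3/2}.$$ Then for all sufficiently large absolute constants $c^*>1$ and all sufficiently large constants $C>1$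 (how large may depend on $c^*$ only) $$\varepsilon_K\le A\,\sqrt{\sigma}\,C_n\,\sqrt{\varepsilon^*}\,n^{1/4}$$ for all $n$, $\sigma$ and $K$ as above, where $A>0$ is an absolute constant. Thus $\varepsilon_K\le A\,C_n\sqrt{\varepsilon^*\cdot\sqrt n\,\sigma}$: up to the logarithmic factor $C_n$, the worst case rate of the least squares estimator is at most the geometric mean of $\varepsilon^*$ and of the trivial rate $\sqrt n\,\sigma=\big(\sup_{\mu\in K}\mathbb E\|Y-\mu\|^2\big)^{1/2}$, the worst case rate of $Y$ itself as an estimator of $\mu$. -/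

import Mathlib

open MeasureTheory ProbabilityTheory Set
open scoped NNReal ENNReal

namespace SequenceModel

noncomputable section

variable {n : ℕ}

/-- The least squares estimator: `lse K y` is a minimizer over `ν ∈ K` of `‖y - ν‖ ^ 2`. For
nonempty closed convex `K` the minimizer exists and is unique, see `lse_eq_iff`. -/
def lse (K : Set (EuclideanSpace ℝ (Fin n))) (y : EuclideanSpace ℝ (Fin n)) :
    EuclideanSpace ℝ (Fin n) :=
  Classical.epsilon fun ν => ν ∈ K ∧ ∀ θ ∈ K, ‖y - ν‖ ^ 2 ≤ ‖y - θ‖ ^ 2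

/-- The risk `𝔼 ‖est Y - μ‖ ^ 2` of the estimator `est` at `μ`, where `Y = μ + ξ` and
`ξ = σ • x` with `x` standard Gaussian, so that `ξ ∼ N(0, σ ^ 2 I_n)`. -/
def risk (σ : ℝ) (est : EuclideanSpace ℝ (Fin n) → EuclideanSpace ℝ (Fin n))
    (μ : EuclideanSpace ℝ (Fin n)) : ℝ≥0∞ :=
  ∫⁻ x, ‖est (μ + σ • x) - μ‖ₑ ^ 2 ∂(stdGaussian (EuclideanSpace ℝ (Fin n)))

/-- The worst case rate of an estimator over `K`: the square root of the worst case risk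
`sup_{μ ∈ K} 𝔼 ‖est Y - μ‖ ^ 2`. -/
def worstCaseRate (K : Set (EuclideanSpace ℝ (Fin n))) (σ : ℝ)
    (est : EuclideanSpace ℝ (Fin n) → EuclideanSpace ℝ (Fin n)) : ℝ≥0∞ :=
  (⨆ μ ∈ K, risk σ est μ) ^ (1 / 2 : ℝ)

/-- The local packing number `sup_{θ ∈ K} M(ε / c, B(θ, ε) ∩ K)`. -/
def localPackingNumber (K : Set (EuclideanSpace ℝ (Fin n))) (c ε : ℝ) : ℕ∞ :=
  ⨆ θ ∈ K, Metric.packingNumber (ε / c).toNNReal (Metric.closedBall θ ε ∩ K)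

/-- The local entropy, the logarithm of the local packing number (which is finite, see
`localPackingNumber_ne_top`). -/
def localEntropy (K : Set (EuclideanSpace ℝ (Fin n))) (c ε : ℝ) : ℝ :=
  Real.log ((localPackingNumber K c ε).toNat : ℝ)

/-- The rate `ε^*`, the supremum of all `ε` with `ε ^ 2 / σ ^ 2` at most the local entropy at `ε`.
The set is bounded, see `bddAbove_minimaxRate`, and it contains `0`. -/
def minimaxRate (K : Set (EuclideanSpace ℝ (Fin n))) (c σ : ℝ) : ℝ :=
  sSup {ε : ℝ | 0 ≤ ε ∧ ε ^ 2 / σ ^ 2 ≤ localEntropy K c ε}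

/-- The logarithmic factor `C_n = 4 C (1 + log_c √(2 π n)) ^ (3 / 2)`. -/
def logFactor (C c : ℝ) (n : ℕ) : ℝ :=
  4 * C * (1 + Real.logb c (√(2 * Real.pi * n))) ^ (3 / 2 : ℝ)

theorem lse_eq_iff {K : Set (EuclideanSpace ℝ (Fin n))} (hne : K.Nonempty) (hcl : IsClosed K)
    (hconv : Convex ℝ K) (y ν : EuclideanSpace ℝ (Fin n)) :
    lse K y = ν ↔ ν ∈ K ∧ ∀ θ ∈ K, ‖y - ν‖ ^ 2 ≤ ‖y - θ‖ ^ 2 := by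
  have key : ∀ v : EuclideanSpace ℝ (Fin n), v ∈ K → (∀ θ ∈ K, ‖y - v‖ ^ 2 ≤ ‖y - θ‖ ^ 2) →
      ‖y - v‖ = ⨅ w : K, ‖y - w‖ := by
    intro v hv h
    have : Nonempty K := hne.to_subtype
    refine le_antisymm (le_ciInf fun w => ?_)
      (ciInf_le ⟨0, forall_mem_range.2 fun _ => norm_nonneg _⟩ (⟨v, hv⟩ : K))
    exact (sq_le_sq₀ (norm_nonneg _) (norm_nonneg _)).1 (h w w.2)
  have hex : ∃ v, v ∈ K ∧ ∀ θ ∈ K, ‖y - v‖ ^ 2 ≤ ‖y - θ‖ ^ 2 := by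
    obtain ⟨v, hv, h⟩ := exists_norm_eq_iInf_of_complete_convex hne hcl.isComplete hconv y
    refine ⟨v, hv, fun θ hθ => ?_⟩
    rw [sq_le_sq₀ (norm_nonneg _) (norm_nonneg _), h]
    exact ciInf_le ⟨0, forall_mem_range.2 fun _ => norm_nonneg _⟩ (⟨θ, hθ⟩ : K)
  have hs : lse K y ∈ K ∧ ∀ θ ∈ K, ‖y - lse K y‖ ^ 2 ≤ ‖y - θ‖ ^ 2 :=
    Classical.epsilon_spec hex
  constructor
  · rintro rfl
    exact hs
  · rintro ⟨hν, hmin⟩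
    have h1 := (norm_eq_iInf_iff_real_inner_le_zero hconv hs.1).1 (key _ hs.1 hs.2) ν hν
    have h2 := (norm_eq_iInf_iff_real_inner_le_zero hconv hν).1 (key _ hν hmin) _ hs.1
    have h3 : inner ℝ (ν - lse K y) (ν - lse K y) ≤ 0 := by
      have e : inner ℝ (ν - lse K y) (ν - lse K y)
          = inner ℝ (y - lse K y) (ν - lse K y) + inner ℝ (y - ν) (lse K y - ν) := by
        simp only [inner_sub_left, inner_sub_right]
        ring
      rw [e]
      linarith
    rw [real_inner_self_eq_norm_sq] at h3
    have h4 : ‖ν - lse K y‖ = 0 := by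
      have := sq_nonneg ‖ν - lse K y‖
      exact pow_eq_zero_iff two_ne_zero |>.1 (le_antisymm h3 this)
    exact (sub_eq_zero.1 (norm_eq_zero.1 h4)).symm

theorem localPackingNumber_le {c : ℝ} (hc : 0 < c) (K : Set (EuclideanSpace ℝ (Fin n)))
    {ε : ℝ} (hε : 0 < ε) :
    localPackingNumber K c ε ≤
      Metric.packingNumber (1 / c).toNNReal
        (Metric.closedBall (0 : EuclideanSpace ℝ (Fin n)) 1) := by
  refine iSup₂_le fun θ _ => iSup₂_le fun S hS => iSup_le fun hsep => ?_
  have hinj : Function.Injective fun x : EuclideanSpace ℝ (Fin n) => ε⁻¹ • (x - θ) := by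
    intro x y h
    simpa using smul_right_injective _ (inv_ne_zero hε.ne') h
  rw [← hinj.encard_image S]
  refine Metric.IsSeparated.encard_le_packingNumber ?_ ?_
  · rintro _ ⟨x, hx, rfl⟩
    have h := (hS hx).1
    rw [mem_closedBall_iff_norm] at h
    rw [mem_closedBall_zero_iff, norm_smul, norm_inv, Real.norm_of_nonneg hε.le]
    rw [inv_mul_le_iff₀ hε]
    simpa using h
  · rintro _ ⟨x, hx, rfl⟩ _ ⟨y, hy, rfl⟩ hne
    have h := hsep hx hy (fun e => hne (by rw [e]))
    have e1 : ((ε / c).toNNReal : ℝ≥0∞) = ENNReal.ofReal (ε / c) := rfl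
    have e2 : ((1 / c).toNNReal : ℝ≥0∞) = ENNReal.ofReal (1 / c) := rfl
    rw [e1, edist_dist, ENNReal.ofReal_lt_ofReal_iff_of_nonneg (by positivity), dist_eq_norm] at h
    rw [e2, edist_dist, ENNReal.ofReal_lt_ofReal_iff_of_nonneg (by positivity), dist_eq_norm,
      ← smul_sub, sub_sub_sub_cancel_right, norm_smul, norm_inv, Real.norm_of_nonneg hε.le,
      lt_inv_mul_iff₀ hε]
    simpa [div_eq_mul_inv] using h

theorem packingNumber_unitBall_ne_top {c : ℝ} (hc : 0 < c) :
    Metric.packingNumber (1 / c).toNNReal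
      (Metric.closedBall (0 : EuclideanSpace ℝ (Fin n)) 1) ≠ ⊤ := by
  have hpos : (0 : ℝ≥0) < (1 / c).toNNReal / 2 := by
    have : 0 < (1 / c).toNNReal := Real.toNNReal_pos.2 (by positivity)
    positivity
  have htb : TotallyBounded (Metric.closedBall (0 : EuclideanSpace ℝ (Fin n)) 1) :=
    (isCompact_closedBall _ _).totallyBounded
  have h := Metric.packingNumber_two_mul_le_externalCoveringNumber ((1 / c).toNNReal / 2)
    (Metric.closedBall (0 : EuclideanSpace ℝ (Fin n)) 1)
  rw [mul_div_cancel₀ _ two_ne_zero] at h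
  refine ne_top_of_le_ne_top ?_ h
  obtain ⟨t, ht, hcov⟩ := Metric.totallyBounded_iff.1 htb _ (NNReal.coe_pos.2 hpos)
  have hC : Metric.IsCover ((1 / c).toNNReal / 2)
      (Metric.closedBall (0 : EuclideanSpace ℝ (Fin n)) 1) t := by
    rw [Metric.isCover_iff_subset_iUnion_closedBall]
    exact hcov.trans (iUnion₂_mono fun _ _ => Metric.ball_subset_closedBall)
  exact ne_top_of_le_ne_top (encard_ne_top_iff.2 ht) hC.externalCoveringNumber_le_encard

theorem localPackingNumber_ne_top {c : ℝ} (hc : 0 < c) (K : Set (EuclideanSpace ℝ (Fin n)))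
    {ε : ℝ} (hε : 0 ≤ ε) : localPackingNumber K c ε ≠ ⊤ := by
  rcases hε.eq_or_lt with rfl | hε
  · refine ne_top_of_le_ne_top ENat.one_ne_top (iSup₂_le fun θ _ => ?_)
    refine (Metric.packingNumber_le_encard_self _).trans ?_
    rw [Metric.closedBall_zero]
    exact (encard_le_encard inter_subset_left).trans (encard_singleton θ).le
  · exact ne_top_of_le_ne_top (packingNumber_unitBall_ne_top hc) (localPackingNumber_le hc K hε)

theorem bddAbove_minimaxRate {c σ : ℝ} (hc : 0 < c) (hσ : 0 < σ)
    (K : Set (EuclideanSpace ℝ (Fin n))) :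
    BddAbove {ε : ℝ | 0 ≤ ε ∧ ε ^ 2 / σ ^ 2 ≤ localEntropy K c ε} := by
  set N := (Metric.packingNumber (1 / c).toNNReal
    (Metric.closedBall (0 : EuclideanSpace ℝ (Fin n)) 1)).toNat with hN
  refine ⟨√(σ ^ 2 * Real.log N), ?_⟩
  rintro ε ⟨h0, h⟩
  rcases h0.eq_or_lt with rfl | h0
  · positivity
  · refine Real.le_sqrt_of_sq_le ?_
    rw [div_le_iff₀ (by positivity), mul_comm] at h
    refine h.trans ?_
    gcongr
    have hle : (localPackingNumber K c ε).toNat ≤ N :=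
      ENat.toNat_le_toNat (localPackingNumber_le hc K h0) (packingNumber_unitBall_ne_top hc)
    rcases Nat.eq_zero_or_pos (localPackingNumber K c ε).toNat with hz | hz
    · rw [localEntropy, hz]
      simpa using Real.log_natCast_nonneg N
    · exact Real.log_le_log (by exact_mod_cast hz) (by exact_mod_cast hle)

end

end SequenceModel

namespace SequenceModel

variable {n : ℕ}

/-! Write `e` for ε* and `N = √n σ`; the claim reduces to risk ≤ 1600 `e N` at every `μ ∈ K`
(`risk_lse_le`).

Projection gives ‖p - μ‖² ≤ ⟨ξ, p - μ⟩ for the estimate `p`. If ‖p - μ‖ ≥ t, shrinking `p` towards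
`μ` gives `z ∈ K` on the sphere of radius `t` with t‖p - μ‖ ≤ ⟨ξ, z - μ⟩. On an `ε`-net of `K ∩ B(μ,
t)` with at most exp H points, the right side costs ε‖ξ‖ plus a Gaussian maximum, so the risk is at
most a multiple of t² + ε²N²/t² + σ²(H + 1) (`risk_lse_le_of_net`).

By convexity local packing numbers decrease in the radius, so refining `k` times, with t ≤ ε c^k,
gives a net of size M^k, where M is the local packing number at `ε` (`exists_finset_net`). For ε =
2e one has log M < ε²/σ², so σ²H = kε². With t² = εN the first two terms are of order eN, and so is
kε² as soon as k ≤ 2 + N/ε. Hence no logarithm is lost: of the factor C_n only C_n ≥ 4C is used. -/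

theorem toNNReal_lt_edist_iff {r : ℝ} (hr : 0 ≤ r) (x y : EuclideanSpace ℝ (Fin n)) :
    (r.toNNReal : ℝ≥0∞) < edist x y ↔ r < ‖x - y‖ := by
  have e : (r.toNNReal : ℝ≥0∞) = ENNReal.ofReal r := rfl
  rw [e, edist_dist, ENNReal.ofReal_lt_ofReal_iff_of_nonneg hr, dist_eq_norm]

/-! ### Packings and nets of convex sets -/

/-- By convexity, the local packing number is nonincreasing in the radius. -/
theorem localPackingNumber_anti {K : Set (EuclideanSpace ℝ (Fin n))} (hconv : Convex ℝ K)
    {c ε s : ℝ} (hc : 0 < c) (hε : 0 < ε) (hs : ε ≤ s) :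
    localPackingNumber K c s ≤ localPackingNumber K c ε := by
  have hs0 : 0 < s := hε.trans_le hs
  have ha0 : 0 < ε / s := by positivity
  have ha1 : ε / s ≤ 1 := (div_le_one hs0).2 hs
  have has : ε / s * s = ε := div_mul_cancel₀ _ hs0.ne'
  generalize ε / s = a at *
  refine iSup₂_le fun θ hθ => iSup₂_le fun S hS => iSup_le fun hsep => ?_
  refine le_iSup₂_of_le θ hθ ?_
  -- The homothety of ratio `a ≤ 1` centred at `θ ∈ K` maps `K` into itself and scales radius and
  -- separation alike.
  have hinj : Function.Injective fun x : EuclideanSpace ℝ (Fin n) => θ + a • (x - θ) := by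
    intro x y h
    have h' : a • (x - θ) = a • (y - θ) := add_left_cancel h
    simpa using smul_right_injective _ ha0.ne' h'
  rw [← hinj.encard_image S]
  refine Metric.IsSeparated.encard_le_packingNumber ?_ ?_
  · rintro _ ⟨x, hx, rfl⟩
    have h := (hS hx).1
    rw [mem_closedBall_iff_norm] at h
    refine ⟨?_, hconv.add_smul_sub_mem hθ (hS hx).2 ⟨ha0.le, ha1⟩⟩
    rw [mem_closedBall_iff_norm, add_sub_cancel_left, norm_smul, Real.norm_of_nonneg ha0.le, ← has]
    gcongr
  · rintro _ ⟨x, hx, rfl⟩ _ ⟨y, hy, rfl⟩ hne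
    have h : ((s / c).toNNReal : ℝ≥0∞) < edist x y := hsep hx hy (fun e => hne (by rw [e]))
    beta_reduce
    rw [toNNReal_lt_edist_iff (by positivity)] at h ⊢
    rw [add_sub_add_left_eq_sub, ← smul_sub, sub_sub_sub_cancel_right, norm_smul,
      Real.norm_of_nonneg ha0.le, ← has, mul_div_assoc]
    gcongr

theorem one_le_localPackingNumber {K : Set (EuclideanSpace ℝ (Fin n))} (hne : K.Nonempty)
    {ε : ℝ} (c : ℝ) (hε : 0 ≤ ε) : 1 ≤ localPackingNumber K c ε := by
  obtain ⟨θ, hθ⟩ := hne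
  refine le_iSup₂_of_le θ hθ ?_
  rw [Order.one_le_iff_pos, Metric.packingNumber_pos_iff]
  exact ⟨θ, Metric.mem_closedBall_self hε, hθ⟩

/-- Iterated local packings: an `ε`-net of `K ∩ B(θ, s)` of cardinality `M ^ k`, where `M` is the
local packing number at scale `ε` and `s ≤ ε c ^ k`. -/
theorem exists_finset_net {K : Set (EuclideanSpace ℝ (Fin n))} (hconv : Convex ℝ K)
    {c ε : ℝ} (hc : 2 ≤ c) (hε : 0 < ε) (k : ℕ) :
    ∀ θ ∈ K, ∀ s : ℝ, 0 ≤ s → s ≤ ε * c ^ k → ∃ S : Finset (EuclideanSpace ℝ (Fin n)),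
      S.card ≤ (localPackingNumber K c ε).toNat ^ k ∧ (∀ ν ∈ S, ‖ν - θ‖ ≤ 2 * s) ∧
      ∀ x ∈ K, ‖x - θ‖ ≤ s → ∃ ν ∈ S, ‖x - ν‖ ≤ ε := by
  classical
  have hc0 : 0 < c := by linarith
  set M := localPackingNumber K c ε with hM
  have hMtop : M ≠ ⊤ := localPackingNumber_ne_top hc0 K hε.le
  induction k with
  | zero =>
    intro θ hθ s hs hsε
    exact ⟨{θ}, by simp, by simpa using hs, fun x _ hx => ⟨θ, by simp, hx.trans (by simpa using hsε)⟩⟩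
  | succ k ih =>
    intro θ hθ s hs hsε
    have hM1 : 1 ≤ M.toNat := by
      have := one_le_localPackingNumber ⟨θ, hθ⟩ c hε.le
      simpa using ENat.toNat_le_toNat this hMtop
    rcases le_total s ε with h | h
    · refine ⟨{θ}, by simpa using Nat.one_le_pow _ _ hM1, by simpa using hs,
        fun x _ hx => ⟨θ, by simp, hx.trans h⟩⟩
    · have hs0 : 0 < s := hε.trans_le h
      have hle : Metric.packingNumber (s / c).toNNReal (Metric.closedBall θ s ∩ K) ≤ M :=
        (le_iSup₂_of_le (f := fun θ _ => Metric.packingNumber (s / c).toNNReal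
          (Metric.closedBall θ s ∩ K)) θ hθ le_rfl).trans
          (localPackingNumber_anti hconv hc0 hε h)
      have htop := ne_top_of_le_ne_top hMtop hle
      -- A maximal `s / c`-separated set is an `s / c`-cover; each of its balls is then refined by
      -- `ih`.
      obtain ⟨T, hTsub, hTcov, hTcard⟩ : ∃ T, T ⊆ Metric.closedBall θ s ∩ K ∧
          Metric.IsCover (s / c).toNNReal (Metric.closedBall θ s ∩ K) T ∧ T.encard ≤ M :=
        ⟨_, Metric.maximalSeparatedSet_subset, Metric.isCover_maximalSeparatedSet htop,
          (Metric.encard_maximalSeparatedSet htop).trans_le hle⟩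
      have hTfin : T.Finite := encard_ne_top_iff.1 (ne_top_of_le_ne_top hMtop hTcard)
      have hsc : s / c ≤ ε * c ^ k := by
        rw [div_le_iff₀ hc0, mul_assoc, ← pow_succ]
        exact hsε
      -- Keeps the net within `2 * s` of `θ`: s + 2s/c ≤ 2s. This is where `2 ≤ c` enters.
      have hsc2 : 2 * (s / c) ≤ s := by
        rw [← mul_div_assoc, div_le_iff₀ hc0, mul_comm]
        gcongr
      have key : ∀ τ : EuclideanSpace ℝ (Fin n), ∃ S : Finset (EuclideanSpace ℝ (Fin n)), τ ∈ T →
          S.card ≤ M.toNat ^ k ∧ (∀ ν ∈ S, ‖ν - τ‖ ≤ 2 * (s / c)) ∧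
          ∀ x ∈ K, ‖x - τ‖ ≤ s / c → ∃ ν ∈ S, ‖x - ν‖ ≤ ε := by
        intro τ
        by_cases hτ : τ ∈ T
        · obtain ⟨S, hS⟩ := ih τ (hTsub hτ).2 (s / c) (by positivity) hsc
          exact ⟨S, fun _ => hS⟩
        · exact ⟨∅, fun h => absurd h hτ⟩
      choose f hf using key
      refine ⟨hTfin.toFinset.biUnion f, ?_, ?_, ?_⟩
      · have h1 := Finset.card_biUnion_le_card_mul hTfin.toFinset f (M.toNat ^ k)
          fun τ hτ => (hf τ (by simpa using hτ)).1
        refine h1.trans ?_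
        rw [pow_succ, mul_comm]
        gcongr
        rw [← ncard_eq_toFinset_card T hTfin]
        exact ENat.toNat_le_toNat hTcard hMtop
      · intro ν hν
        obtain ⟨τ, hτ, hν⟩ := Finset.mem_biUnion.1 hν
        have hτ : τ ∈ T := by simpa using hτ
        have h1 := (hf τ hτ).2.1 ν hν
        have h2 := mem_closedBall_iff_norm.1 (hTsub hτ).1
        have h3 := norm_sub_le_norm_sub_add_norm_sub ν τ θ
        linarith
      · intro x hx hxs
        rw [Metric.isCover_iff_subset_iUnion_closedBall] at hTcov
        have h1 := hTcov ⟨mem_closedBall_iff_norm.2 hxs, hx⟩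
        obtain ⟨τ, hτ, h2⟩ := mem_iUnion₂.1 h1
        rw [mem_closedBall_iff_norm, Real.coe_toNNReal _ (by positivity)] at h2
        obtain ⟨ν, hν, h3⟩ := (hf τ hτ).2.2 x hx h2
        exact ⟨ν, Finset.mem_biUnion.2 ⟨τ, by simpa using hτ, hν⟩, h3⟩

/-- A convex set whose local packing number at scale `ε` is one has diameter at most `ε`. -/
theorem norm_sub_le_of_localPackingNumber_le_one {K : Set (EuclideanSpace ℝ (Fin n))}
    (hconv : Convex ℝ K) {c ε : ℝ} (hc : 1 < c) (hε : 0 < ε)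
    (h : localPackingNumber K c ε ≤ 1) {x y : EuclideanSpace ℝ (Fin n)} (hx : x ∈ K) (hy : y ∈ K) :
    ‖x - y‖ ≤ ε := by
  by_contra! hlt
  have hd : 0 < ‖x - y‖ := hε.trans hlt
  -- `z` lies on the segment at distance exactly `ε` from `y`, so `{z, y}` is an `ε / c`-separated
  -- pair in `B(y, ε)`.
  set z := y + (ε / ‖x - y‖) • (x - y) with hz
  have hzK : z ∈ K := hconv.add_smul_sub_mem hy hx ⟨by positivity, (div_le_one hd).2 hlt.le⟩
  have hzy : ‖z - y‖ = ε := by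
    rw [hz, add_sub_cancel_left, norm_smul, Real.norm_of_nonneg (by positivity),
      div_mul_cancel₀ _ hd.ne']
  have hne : z ≠ y := by
    rintro e
    rw [e, sub_self, norm_zero] at hzy
    exact hε.ne hzy
  have hεc : ε / c < ε := div_lt_self hε hc
  have h2 : ({z, y} : Set (EuclideanSpace ℝ (Fin n))).encard ≤ 1 := by
    refine (Metric.IsSeparated.encard_le_packingNumber (ε := (ε / c).toNNReal)
      (A := Metric.closedBall y ε ∩ K) ?_ ?_).trans ((le_iSup₂_of_le
        (f := fun θ _ => Metric.packingNumber (ε / c).toNNReal (Metric.closedBall θ ε ∩ K))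
        y hy le_rfl).trans h)
    · rintro w (rfl | rfl)
      · exact ⟨mem_closedBall_iff_norm.2 hzy.le, hzK⟩
      · exact ⟨Metric.mem_closedBall_self hε.le, hy⟩
    · have hpos : 0 ≤ ε / c := by positivity
      rintro u (rfl | rfl) v (rfl | rfl) huv
      · exact absurd rfl huv
      · rw [toNNReal_lt_edist_iff hpos, hzy]; exact hεc
      · rw [toNNReal_lt_edist_iff hpos, norm_sub_rev, hzy]; exact hεc
      · exact absurd rfl huv
  rw [encard_pair hne] at h2
  exact absurd h2 (by decide)

/-! ### Gaussian moments and the risk -/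

theorem integral_exp_inner_stdGaussian (v : EuclideanSpace ℝ (Fin n)) :
    Integrable (fun x => Real.exp (inner ℝ v x)) (stdGaussian (EuclideanSpace ℝ (Fin n))) ∧
    ∫ x, Real.exp (inner ℝ v x) ∂(stdGaussian (EuclideanSpace ℝ (Fin n)))
      = Real.exp (‖v‖ ^ 2 / 2) := by
  have hmap := IsGaussian.map_eq_gaussianReal (μ := stdGaussian (EuclideanSpace ℝ (Fin n)))
    (innerSL ℝ v)
  rw [integral_strongDual_stdGaussian, variance_dual_stdGaussian, innerSL_apply_norm] at hmap
  have hint := mgf_gaussianReal hmap 1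
  rw [Real.coe_toNNReal _ (by positivity)] at hint
  have h2 : ∫ x, Real.exp (inner ℝ v x) ∂(stdGaussian (EuclideanSpace ℝ (Fin n)))
      = Real.exp (‖v‖ ^ 2 / 2) := by
    simpa [mgf] using hint
  refine ⟨?_, h2⟩
  -- A non-integrable function has integral `0` by convention, but the value found is positive.
  by_contra h
  rw [integral_undef h] at h2
  exact (Real.exp_pos _).ne h2

theorem integral_norm_sq_stdGaussian :
    Integrable (fun x => ‖x‖ ^ 2) (stdGaussian (EuclideanSpace ℝ (Fin n))) ∧
    ∫ x, ‖x‖ ^ 2 ∂(stdGaussian (EuclideanSpace ℝ (Fin n))) = n := by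
  have hint : Integrable (fun x => ‖x‖ ^ 2) (stdGaussian (EuclideanSpace ℝ (Fin n))) :=
    (IsGaussian.memLp_two_id (μ := stdGaussian (EuclideanSpace ℝ (Fin n)))).integrable_norm_pow
      two_ne_zero
  refine ⟨hint, ?_⟩
  set b := EuclideanSpace.basisFun (Fin n) ℝ
  have hsum : ∀ x : EuclideanSpace ℝ (Fin n), ‖x‖ ^ 2 = ∑ i, (innerSL ℝ (b i) x) ^ 2 := by
    intro x
    rw [← b.sum_sq_norm_inner_right x]
    simp
  have hvar : ∀ i, ∫ x, (innerSL ℝ (b i) x) ^ 2 ∂(stdGaussian (EuclideanSpace ℝ (Fin n))) = 1 := by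
    intro i
    have h := variance_dual_stdGaussian (innerSL ℝ (b i))
    rw [variance_eq_integral (innerSL ℝ (b i)).continuous.aemeasurable,
      integral_strongDual_stdGaussian, innerSL_apply_norm, b.norm_eq_one] at h
    simpa using h
  simp_rw [hsum]
  rw [integral_finsetSum, Finset.sum_congr rfl fun i _ => hvar i]
  · simp
  · intro i _
    by_contra h
    have := hvar i
    rw [integral_undef h] at this
    exact zero_ne_one this

theorem risk_le_of_sq_le {σ R : ℝ} {est : EuclideanSpace ℝ (Fin n) → EuclideanSpace ℝ (Fin n)}
    {μ : EuclideanSpace ℝ (Fin n)} {f : EuclideanSpace ℝ (Fin n) → ℝ}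
    (hf : Integrable f (stdGaussian (EuclideanSpace ℝ (Fin n))))
    (hle : ∀ x, ‖est (μ + σ • x) - μ‖ ^ 2 ≤ f x)
    (hR : ∫ x, f x ∂(stdGaussian (EuclideanSpace ℝ (Fin n))) ≤ R) :
    risk σ est μ ≤ ENNReal.ofReal R := by
  refine le_trans ?_ (ENNReal.ofReal_le_ofReal hR)
  rw [ofReal_integral_eq_lintegral_ofReal hf
    (Filter.Eventually.of_forall fun x => (sq_nonneg _).trans (hle x))]
  refine lintegral_mono fun x => ?_
  rw [← ofReal_norm, ← ENNReal.ofReal_pow (norm_nonneg _)]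
  exact ENNReal.ofReal_le_ofReal (hle x)

theorem risk_id (σ : ℝ) (μ : EuclideanSpace ℝ (Fin n)) :
    risk σ (fun y => y) μ = ENNReal.ofReal (n * σ ^ 2) := by
  have h1 : ∀ x : EuclideanSpace ℝ (Fin n), ‖μ + σ • x - μ‖ₑ ^ 2
      = ENNReal.ofReal (‖x‖ ^ 2 * σ ^ 2) := by
    intro x
    rw [add_sub_cancel_left, ← ofReal_norm, ← ENNReal.ofReal_pow (norm_nonneg _),
      norm_smul, mul_pow, Real.norm_eq_abs, sq_abs, mul_comm]
  obtain ⟨hi, hv⟩ := integral_norm_sq_stdGaussian (n := n)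
  rw [risk, lintegral_congr h1, ← ofReal_integral_eq_lintegral_ofReal (hi.mul_const _)
    (Filter.Eventually.of_forall fun x => by positivity), integral_mul_const, hv]

/-! ### Risk of the least squares estimator from a net -/

theorem norm_lse_sub_sq_le {K : Set (EuclideanSpace ℝ (Fin n))} (hcl : IsClosed K)
    (hconv : Convex ℝ K) {μ : EuclideanSpace ℝ (Fin n)} (hμ : μ ∈ K)
    (ξ : EuclideanSpace ℝ (Fin n)) :
    ‖lse K (μ + ξ) - μ‖ ^ 2 ≤ inner ℝ ξ (lse K (μ + ξ) - μ) := by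
  have : Nonempty K := ⟨⟨μ, hμ⟩⟩
  obtain ⟨hp, hmin⟩ := (lse_eq_iff ⟨μ, hμ⟩ hcl hconv (μ + ξ) _).1 rfl
  set p := lse K (μ + ξ)
  -- The obtuse angle property of the projection, tested at `μ`.
  have h := (norm_eq_iInf_iff_real_inner_le_zero hconv hp).1 (le_antisymm
    (le_ciInf fun w => (sq_le_sq₀ (norm_nonneg _) (norm_nonneg _)).1 (hmin w w.2))
    (ciInf_le ⟨0, forall_mem_range.2 fun _ => norm_nonneg _⟩ (⟨p, hp⟩ : K))) μ hμ
  have e : inner ℝ (μ + ξ - p) (μ - p) = ‖p - μ‖ ^ 2 - inner ℝ ξ (p - μ) := by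
    rw [← real_inner_self_eq_norm_sq, ← inner_sub_left, ← inner_neg_neg]
    congr 1 <;> abel
  linarith

theorem lse_mem {K : Set (EuclideanSpace ℝ (Fin n))} (hne : K.Nonempty) (hcl : IsClosed K)
    (hconv : Convex ℝ K) (y : EuclideanSpace ℝ (Fin n)) : lse K y ∈ K :=
  ((lse_eq_iff hne hcl hconv y _).1 rfl).1

/-- For y ≥ a, use y² ≤ 2a² + 2(y - a)² and u²/2 ≤ exp u. The exponential lets a maximum over the
net be replaced by a sum. -/
theorem posPart_sq_le_exp (y : ℝ) {a : ℝ} (ha : 0 ≤ a) :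
    max y 0 ^ 2 ≤ 2 * a ^ 2 + 4 * Real.exp (y - a) := by
  have he := Real.exp_pos (y - a)
  rcases le_total y a with h | h
  · have h1 : max y 0 ≤ a := max_le h ha
    have h2 : 0 ≤ max y 0 := le_max_right _ _
    nlinarith
  · rw [max_eq_left (ha.trans h)]
    have := Real.quadratic_le_exp_of_nonneg (sub_nonneg.2 h)
    nlinarith [sq_nonneg (y - 2 * a)]

/-- The deterministic part of the bound: a point `p` satisfying the basic inequality is controlled
by the noise on an `ε`-net of `K ∩ B(μ, t)`. -/
theorem norm_sub_sq_le_of_net {K : Set (EuclideanSpace ℝ (Fin n))} (hconv : Convex ℝ K)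
    {p μ x : EuclideanSpace ℝ (Fin n)} (hp : p ∈ K) (hμ : μ ∈ K) {σ t ε l : ℝ} (hσ : 0 < σ)
    (ht : 0 < t) (hl : 0 < l) (hb : ‖p - μ‖ ^ 2 ≤ inner ℝ (σ • x) (p - μ))
    {S : Finset (EuclideanSpace ℝ (Fin n))}
    (hS : ∀ z ∈ K, ‖z - μ‖ ≤ t → ∃ ν ∈ S, ‖z - ν‖ ≤ ε) :
    ‖p - μ‖ ^ 2 ≤ t ^ 2 + (2 * (ε * σ) ^ 2 * ‖x‖ ^ 2 + 2 * (2 * σ * t / l) ^ 2 *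
      (2 * (l ^ 2) ^ 2 + 4 * ∑ ν ∈ S, Real.exp (-l ^ 2) *
        Real.exp (inner ℝ ((l / (2 * t)) • (ν - μ)) x))) / t ^ 2 := by
  have hsum : 0 ≤ ∑ ν ∈ S, Real.exp (-l ^ 2) * Real.exp (inner ℝ ((l / (2 * t)) • (ν - μ)) x) :=
    Finset.sum_nonneg fun _ _ => by positivity
  rcases le_total ‖p - μ‖ t with h | h
  · refine (pow_le_pow_left₀ (norm_nonneg _) h 2).trans (le_add_of_nonneg_right ?_)
    positivity
  have hD : 0 < ‖p - μ‖ := ht.trans_le h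
  set z := μ + (t / ‖p - μ‖) • (p - μ) with hz
  have hzK : z ∈ K := hconv.add_smul_sub_mem hμ hp ⟨by positivity, (div_le_one hD).2 h⟩
  have hzμ : z - μ = (t / ‖p - μ‖) • (p - μ) := by rw [hz, add_sub_cancel_left]
  have hzt : ‖z - μ‖ = t := by
    rw [hzμ, norm_smul, Real.norm_of_nonneg (by positivity), div_mul_cancel₀ _ hD.ne']
  obtain ⟨ν, hν, hzν⟩ := hS z hzK hzt.le
  have h1 : t * ‖p - μ‖ ≤ inner ℝ (σ • x) (z - μ) := by
    rw [hzμ, inner_smul_right]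
    calc t * ‖p - μ‖ = t / ‖p - μ‖ * ‖p - μ‖ ^ 2 := by field_simp
      _ ≤ _ := by gcongr
  have h2 : inner ℝ (σ • x) (z - μ) ≤ ε * σ * ‖x‖ + σ * inner ℝ x (ν - μ) := by
    have e : z - μ = (z - ν) + (ν - μ) := by abel
    rw [e, inner_add_right]
    refine add_le_add ((real_inner_le_norm _ _).trans ?_) (real_inner_smul_left _ _ _).le
    rw [norm_smul, Real.norm_of_nonneg hσ.le]
    calc σ * ‖x‖ * ‖z - ν‖ ≤ σ * ‖x‖ * ε := by gcongr
      _ = _ := by ring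
  -- Net points lie within `2 * t` of `μ` in the application, so this normalization gives standard
  -- deviation at most `l`; the truncation level is `l ^ 2`.
  set y := inner ℝ ((l / (2 * t)) • (ν - μ)) x with hy
  have h3 : σ * inner ℝ x (ν - μ) = 2 * σ * t / l * y := by
    rw [hy, real_inner_smul_left, real_inner_comm]
    field_simp
  have h4 : t * ‖p - μ‖ ≤ ε * σ * ‖x‖ + 2 * σ * t / l * max y 0 := by
    have : 2 * σ * t / l * y ≤ 2 * σ * t / l * max y 0 := by
      gcongr
      exact le_max_left _ _
    linarith
  have h5 : (t * ‖p - μ‖) ^ 2 ≤ 2 * (ε * σ) ^ 2 * ‖x‖ ^ 2 + 2 * (2 * σ * t / l) ^ 2 * max y 0 ^ 2 := by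
    have := pow_le_pow_left₀ (by positivity) h4 2
    refine this.trans (add_sq_le.trans_eq ?_)
    ring
  have h6 : max y 0 ^ 2 ≤ 2 * (l ^ 2) ^ 2 + 4 * ∑ ν ∈ S, Real.exp (-l ^ 2) *
      Real.exp (inner ℝ ((l / (2 * t)) • (ν - μ)) x) := by
    refine (posPart_sq_le_exp y (sq_nonneg l)).trans ?_
    gcongr
    rw [sub_eq_add_neg, Real.exp_add, mul_comm]
    exact Finset.single_le_sum (f := fun ν => Real.exp (-l ^ 2) *
      Real.exp (inner ℝ ((l / (2 * t)) • (ν - μ)) x)) (fun _ _ => by positivity) hν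
  have h7 : ‖p - μ‖ ^ 2 ≤ (2 * (ε * σ) ^ 2 * ‖x‖ ^ 2 + 2 * (2 * σ * t / l) ^ 2 *
      (2 * (l ^ 2) ^ 2 + 4 * ∑ ν ∈ S, Real.exp (-l ^ 2) *
        Real.exp (inner ℝ ((l / (2 * t)) • (ν - μ)) x))) / t ^ 2 := by
    rw [le_div_iff₀ (by positivity), ← mul_pow, mul_comm]
    refine h5.trans ?_
    gcongr
  exact h7.trans (le_add_of_nonneg_left (sq_nonneg t))

theorem integral_affine_comb {Ω : Type*} [MeasurableSpace Ω] {P : Measure Ω}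
    [IsProbabilityMeasure P] {f g : Ω → ℝ} (hf : Integrable f P) (hg : Integrable g P)
    (a b d e q : ℝ) :
    Integrable (fun x => a + (b * f x + d * (e + 4 * g x)) / q) P ∧
    ∫ x, (a + (b * f x + d * (e + 4 * g x)) / q) ∂P
      = a + (b * ∫ x, f x ∂P + d * (e + 4 * ∫ x, g x ∂P)) / q := by
  have h1 : Integrable (fun x => e + 4 * g x) P := (integrable_const e).add (hg.const_mul 4)
  have h2 : Integrable (fun x => b * f x + d * (e + 4 * g x)) P :=
    (hf.const_mul b).add (h1.const_mul d)
  refine ⟨(integrable_const a).add (h2.div_const q), ?_⟩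
  rw [integral_add (integrable_const a) (h2.div_const q), integral_div,
    integral_add (hf.const_mul b) (h1.const_mul d), integral_const_mul, integral_const_mul,
    integral_add (integrable_const e) (hg.const_mul 4), integral_const_mul]
  simp

/-- The risk of the least squares estimator at `μ` in terms of the log-cardinality of an `ε`-net of
`K ∩ B(μ, t)`. -/
theorem risk_lse_le_of_net {K : Set (EuclideanSpace ℝ (Fin n))} (hcl : IsClosed K)
    (hconv : Convex ℝ K) {μ : EuclideanSpace ℝ (Fin n)} (hμ : μ ∈ K) {σ t ε H : ℝ} (hσ : 0 < σ)
    (ht : 0 < t) (hH : 0 ≤ H) {S : Finset (EuclideanSpace ℝ (Fin n))}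
    (hcard : (S.card : ℝ) ≤ Real.exp H) (hSt : ∀ ν ∈ S, ‖ν - μ‖ ≤ 2 * t)
    (hS : ∀ z ∈ K, ‖z - μ‖ ≤ t → ∃ ν ∈ S, ‖z - ν‖ ≤ ε) :
    risk σ (lse K) μ ≤
      ENNReal.ofReal (t ^ 2 + 2 * (ε * σ) ^ 2 * n / t ^ 2 + 32 * σ ^ 2 * (H + 2)) := by
  have hl0 : 0 < 2 * (H + 1) := by positivity
  -- Each exponential moment is at most exp(-l² + l²/2) = exp(-(H + 1)), which beats the cardinality
  -- exp H; the `+ 1` keeps `l` positive when `H = 0`.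
  set l := √(2 * (H + 1)) with hl
  have hl2 : l ^ 2 = 2 * (H + 1) := Real.sq_sqrt hl0.le
  have hlpos : 0 < l := Real.sqrt_pos.2 hl0
  obtain ⟨hi, hv⟩ := integral_norm_sq_stdGaussian (n := n)
  have hexp : ∀ ν ∈ S, Integrable (fun x => Real.exp (-l ^ 2) *
      Real.exp (inner ℝ ((l / (2 * t)) • (ν - μ)) x))
      (stdGaussian (EuclideanSpace ℝ (Fin n))) := fun ν _ =>
    (integral_exp_inner_stdGaussian _).1.const_mul _
  have hsumi := integrable_finsetSum S hexp
  have hsum1 : ∫ x, ∑ ν ∈ S, Real.exp (-l ^ 2) * Real.exp (inner ℝ ((l / (2 * t)) • (ν - μ)) x)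
      ∂(stdGaussian (EuclideanSpace ℝ (Fin n))) ≤ 1 := by
    rw [integral_finsetSum S hexp]
    calc _ ≤ ∑ ν ∈ S, Real.exp (-H) := by
            refine Finset.sum_le_sum fun ν hν => ?_
            rw [integral_const_mul, (integral_exp_inner_stdGaussian _).2, ← Real.exp_add,
              Real.exp_le_exp]
            have : ‖(l / (2 * t)) • (ν - μ)‖ ≤ l := by
              rw [norm_smul, Real.norm_of_nonneg (by positivity)]
              calc l / (2 * t) * ‖ν - μ‖ ≤ l / (2 * t) * (2 * t) := by gcongr; exact hSt ν hν
                _ = l := by field_simp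
            have := pow_le_pow_left₀ (norm_nonneg _) this 2
            rw [hl2] at this ⊢
            linarith
      _ = S.card * Real.exp (-H) := by rw [Finset.sum_const, nsmul_eq_mul]
      _ ≤ Real.exp H * Real.exp (-H) := by gcongr
      _ = 1 := by rw [← Real.exp_add, add_neg_cancel, Real.exp_zero]
  obtain ⟨hint, hval⟩ := integral_affine_comb hi hsumi (t ^ 2) (2 * (ε * σ) ^ 2)
    (2 * (2 * σ * t / l) ^ 2) (2 * (l ^ 2) ^ 2) (t ^ 2)
  refine risk_le_of_sq_le hint (fun x => norm_sub_sq_le_of_net hconv (lse_mem ⟨μ, hμ⟩ hcl hconv _)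
    hμ hσ ht hlpos (norm_lse_sub_sq_le hcl hconv hμ (σ • x)) hS) ?_
  rw [hval, hv]
  generalize (∫ x, ∑ ν ∈ S, Real.exp (-l ^ 2) * Real.exp (inner ℝ ((l / (2 * t)) • (ν - μ)) x)
      ∂(stdGaussian (EuclideanSpace ℝ (Fin n)))) = I at hsum1
  have e : t ^ 2 + (2 * (ε * σ) ^ 2 * n + 2 * (2 * σ * t / l) ^ 2 * (2 * (l ^ 2) ^ 2 + 4 * I)) / t ^ 2
      = t ^ 2 + 2 * (ε * σ) ^ 2 * n / t ^ 2 + 16 * σ ^ 2 * (l ^ 2 + 2 * I / l ^ 2) := by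
    field_simp
    ring
  rw [e, hl2]
  have h1 : 2 * I / (2 * (H + 1)) ≤ 2 := by
    rw [div_le_iff₀ hl0]
    linarith
  nlinarith [mul_le_mul_of_nonneg_left h1 (sq_nonneg σ)]

theorem risk_lse_le_trivial {K : Set (EuclideanSpace ℝ (Fin n))} (hcl : IsClosed K)
    (hconv : Convex ℝ K) {μ : EuclideanSpace ℝ (Fin n)} (hμ : μ ∈ K) (σ : ℝ) :
    risk σ (lse K) μ ≤ ENNReal.ofReal (n * σ ^ 2) := by
  obtain ⟨hi, hv⟩ := integral_norm_sq_stdGaussian (n := n)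
  refine risk_le_of_sq_le (hi.mul_const (σ ^ 2)) (fun x => ?_) (by rw [integral_mul_const, hv])
  have h := (norm_lse_sub_sq_le hcl hconv hμ (σ • x)).trans (real_inner_le_norm _ _)
  have h1 : ‖lse K (μ + σ • x) - μ‖ ≤ ‖σ • x‖ := by
    rcases (norm_nonneg (lse K (μ + σ • x) - μ)).eq_or_lt with h0 | h0
    · rw [← h0]
      positivity
    · rw [sq] at h
      exact le_of_mul_le_mul_right h h0
  refine (pow_le_pow_left₀ (norm_nonneg _) h1 2).trans_eq ?_
  rw [norm_smul, mul_pow, Real.norm_eq_abs, sq_abs, mul_comm]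

theorem risk_lse_le_of_forall_norm_sub_le {K : Set (EuclideanSpace ℝ (Fin n))} (hcl : IsClosed K)
    (hconv : Convex ℝ K) {μ : EuclideanSpace ℝ (Fin n)} (hμ : μ ∈ K) (σ : ℝ) {d : ℝ}
    (hd : ∀ x ∈ K, ‖x - μ‖ ≤ d) : risk σ (lse K) μ ≤ ENNReal.ofReal (d ^ 2) := by
  refine risk_le_of_sq_le (integrable_const (d ^ 2))
    (fun x => pow_le_pow_left₀ (norm_nonneg _) (hd _ (lse_mem ⟨μ, hμ⟩ hcl hconv _)) 2) ?_
  simp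

/-! ### The critical radius and the choice of scale -/

theorem minimaxRate_nonneg (K : Set (EuclideanSpace ℝ (Fin n))) (c σ : ℝ) :
    0 ≤ minimaxRate K c σ :=
  Real.sSup_nonneg fun _ h => h.1

theorem localEntropy_lt_of_minimaxRate_lt {K : Set (EuclideanSpace ℝ (Fin n))} {c σ ε : ℝ}
    (hc : 0 < c) (hσ : 0 < σ) (h : minimaxRate K c σ < ε) :
    localEntropy K c ε < ε ^ 2 / σ ^ 2 := by
  by_contra! h'
  exact notMem_of_csSup_lt h (bddAbove_minimaxRate hc hσ K)
    ⟨(minimaxRate_nonneg K c σ).trans h.le, h'⟩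

/-- If the minimax rate is below `σ √(1 / 2)`, then it bounds the diameter. -/
theorem norm_sub_le_minimaxRate {K : Set (EuclideanSpace ℝ (Fin n))} (hconv : Convex ℝ K)
    {c σ : ℝ} (hc : 1 < c) (hσ : 0 < σ) (h : 2 * minimaxRate K c σ ^ 2 < σ ^ 2)
    {x y : EuclideanSpace ℝ (Fin n)} (hx : x ∈ K) (hy : y ∈ K) :
    ‖x - y‖ ≤ minimaxRate K c σ := by
  have hc0 : 0 < c := by linarith
  have h0 := minimaxRate_nonneg K c σ
  have hlt : minimaxRate K c σ < σ * √(1 / 2) := by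
    refine lt_of_pow_lt_pow_left₀ 2 (by positivity) ?_
    rw [mul_pow, Real.sq_sqrt (by norm_num)]
    linarith
  refine le_of_forall_gt_imp_ge_of_dense fun s hs => ?_
  wlog hs2 : s < σ * √(1 / 2) generalizing s
  · obtain ⟨s', h1, h2⟩ := exists_between hlt
    exact (this s' h1 h2).trans (h2.le.trans (not_lt.1 hs2))
  have hs0 : 0 < s := h0.trans_lt hs
  refine norm_sub_le_of_localPackingNumber_le_one hconv hc hs0 ?_ hx hy
  have hent := localEntropy_lt_of_minimaxRate_lt hc0 hσ hs
  have htop := localPackingNumber_ne_top hc0 K hs0.le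
  -- Since 1/2 < log 2, the entropy at `s` is below log 2, so the packing number is at most one.
  have h2 : s ^ 2 / σ ^ 2 < Real.log 2 := by
    have h3 : s ^ 2 / σ ^ 2 < 1 / 2 := by
      rw [div_lt_iff₀ (by positivity)]
      have := pow_lt_pow_left₀ hs2 hs0.le two_ne_zero
      rw [mul_pow, Real.sq_sqrt (by norm_num)] at this
      linarith
    linarith [Real.log_two_gt_d9]
  rw [localEntropy] at hent
  have hlt2 : (localPackingNumber K c s).toNat < 2 := by
    by_contra! hge
    have : Real.log 2 ≤ Real.log ((localPackingNumber K c s).toNat : ℝ) :=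
      Real.log_le_log two_pos (by exact_mod_cast hge)
    linarith
  rw [← ENat.natCast_toNat htop]
  exact_mod_cast Nat.le_of_lt_succ hlt2

/-- Three regimes: for 2e² < σ² the diameter is at most `e`; for e ≥ N the trivial bound N²
suffices; in between the net bound applies, and σ² ≤ 2e² ≤ 2eN absorbs the leftover σ² term. -/
theorem risk_lse_le {K : Set (EuclideanSpace ℝ (Fin n))} (hcl : IsClosed K)
    (hconv : Convex ℝ K) (hn : 1 ≤ n) {c σ : ℝ} (hc : 2 ≤ c) (hσ : 0 < σ)
    {μ : EuclideanSpace ℝ (Fin n)} (hμ : μ ∈ K) :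
    risk σ (lse K) μ ≤ ENNReal.ofReal (1600 * (minimaxRate K c σ * (√n * σ))) := by
  have hc0 : 0 < c := by linarith
  set e := minimaxRate K c σ with he
  have he0 : 0 ≤ e := minimaxRate_nonneg K c σ
  have hn1 : 1 ≤ √(n : ℝ) := Real.one_le_sqrt.2 (by exact_mod_cast hn)
  set N := √(n : ℝ) * σ with hN
  have hσN : σ ≤ N := le_mul_of_one_le_left hσ.le hn1
  have hN0 : 0 < N := hσ.trans_le hσN
  have hNsq : n * σ ^ 2 = N ^ 2 := by rw [hN, mul_pow, Real.sq_sqrt (Nat.cast_nonneg n)]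
  have heN0 : 0 ≤ e * N := by positivity
  rcases lt_or_ge (2 * e ^ 2) (σ ^ 2) with hsmall | hσe
  · have heσ : e ≤ σ := by
      refine le_of_sq_le_sq ?_ hσ.le
      nlinarith
    refine (risk_lse_le_of_forall_norm_sub_le hcl hconv hμ σ fun x hx =>
      norm_sub_le_minimaxRate hconv (by linarith) hσ hsmall hx hμ).trans
      (ENNReal.ofReal_le_ofReal ?_)
    rw [← he]
    nlinarith [mul_le_mul_of_nonneg_left (heσ.trans hσN) he0]
  rcases le_total N e with hlarge | heN
  · refine (risk_lse_le_trivial hcl hconv hμ σ).trans (ENNReal.ofReal_le_ofReal ?_)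
    rw [hNsq]
    nlinarith
  have hepos : 0 < e := by
    refine he0.lt_of_ne fun h => ?_
    rw [← h] at hσe
    nlinarith [pow_pos hσ 2]
  -- Strictly above the supremum `e`, so the defining inequality fails at `ε`.
  set ε := 2 * e with hε
  have hε0 : 0 < ε := by positivity
  have hent := localEntropy_lt_of_minimaxRate_lt (K := K) hc0 hσ (show e < ε by linarith)
  set r := N / ε with hr
  have hr0 : 0 < r := by positivity
  have hrε : r * ε = N := div_mul_cancel₀ _ hε0.ne'
  -- About log_c √r refinements would do, but only √r ≤ c^k and k ≤ 2 + r are needed, since r ε² =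
  -- εN is the target.
  set k := ⌈√r⌉₊ with hk
  have hk1 : (k : ℝ) ≤ 2 + r := by
    have h1 := Nat.ceil_lt_add_one (Real.sqrt_nonneg r)
    have h2 : √r ≤ 1 + r := by
      nlinarith [Real.sq_sqrt hr0.le, sq_nonneg (√r - 1), Real.sqrt_nonneg r]
    linarith
  have hk2 : √r ≤ c ^ k := by
    calc √r ≤ k := Nat.le_ceil _
      _ ≤ 2 ^ k := by exact_mod_cast Nat.lt_two_pow_self.le
      _ ≤ c ^ k := by gcongr
  have ht0 : 0 < ε * √r := by positivity
  have ht2 : (ε * √r) ^ 2 = ε * N := by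
    rw [mul_pow, Real.sq_sqrt hr0.le, ← hrε]
    ring
  -- The radius t = ε√r, that is t² = εN, balances t² against ε²N²/t².
  obtain ⟨S, hcard, hSt, hS⟩ := exists_finset_net hconv hc hε0 k μ hμ (ε * √r) ht0.le (by gcongr)
  have hM1 : 0 < (localPackingNumber K c ε).toNat := by
    have := ENat.toNat_le_toNat (one_le_localPackingNumber ⟨μ, hμ⟩ c hε0.le)
      (localPackingNumber_ne_top hc0 K hε0.le)
    simpa [Nat.one_le_iff_ne_zero, Nat.pos_iff_ne_zero] using this
  have hcard' : (S.card : ℝ) ≤ Real.exp (k * (ε ^ 2 / σ ^ 2)) := by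
    rw [Real.exp_nat_mul]
    have h1 : (S.card : ℝ) ≤ ((localPackingNumber K c ε).toNat : ℝ) ^ k := by exact_mod_cast hcard
    refine h1.trans ?_
    gcongr
    rw [← Real.log_le_iff_le_exp (by exact_mod_cast hM1)]
    exact hent.le
  refine (risk_lse_le_of_net hcl hconv hμ hσ ht0 (by positivity) hcard' hSt hS).trans
    (ENNReal.ofReal_le_ofReal ?_)
  have h1 : 2 * (ε * σ) ^ 2 * n / (ε * √r) ^ 2 = 2 * (ε * N) := by
    have : 2 * (ε * σ) ^ 2 * n = 2 * (ε * N) * (ε * N) := by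
      linear_combination 2 * ε ^ 2 * hNsq
    rw [this, ht2, mul_div_cancel_right₀ _ (by positivity)]
  have h2 : 32 * σ ^ 2 * (k * (ε ^ 2 / σ ^ 2) + 2) = 32 * (k * ε ^ 2) + 64 * σ ^ 2 := by
    field_simp
    ring
  have h3 : (k : ℝ) * ε ^ 2 ≤ 2 * ε ^ 2 + ε * N := by
    calc (k : ℝ) * ε ^ 2 ≤ (2 + r) * ε ^ 2 := by gcongr
      _ = _ := by rw [← hrε]; ring
  have h4 : e ^ 2 ≤ e * N := by nlinarith
  rw [h1, h2, ht2]
  have h5 : ε * N = 2 * (e * N) := by rw [hε]; ring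
  have h6 : ε ^ 2 = 4 * e ^ 2 := by rw [hε]; ring
  rw [h5, h6] at h3
  rw [h5]
  linarith

/-! ### From the pointwise risk to the worst case rate -/

theorem four_mul_le_logFactor {C c : ℝ} (hC : 0 ≤ C) (hc : 1 < c) (hn : 1 ≤ n) :
    4 * C ≤ logFactor C c n := by
  have hn' : (1 : ℝ) ≤ n := by exact_mod_cast hn
  have h1 : 1 ≤ √(2 * Real.pi * n) := by
    rw [Real.one_le_sqrt]
    nlinarith [Real.pi_gt_three]
  have h2 := Real.logb_nonneg hc h1
  refine le_mul_of_one_le_right (by positivity) (Real.one_le_rpow (by linarith) (by norm_num))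

theorem worstCaseRate_le_ofReal {K : Set (EuclideanSpace ℝ (Fin n))} {σ R : ℝ} (hR : 0 ≤ R)
    {est : EuclideanSpace ℝ (Fin n) → EuclideanSpace ℝ (Fin n)}
    (h : ∀ μ ∈ K, risk σ est μ ≤ ENNReal.ofReal R) :
    worstCaseRate K σ est ≤ ENNReal.ofReal √R := by
  rw [worstCaseRate, Real.sqrt_eq_rpow, ← ENNReal.ofReal_rpow_of_nonneg hR (by norm_num)]
  exact ENNReal.rpow_le_rpow (iSup₂_le h) (by norm_num)

theorem worstCaseRate_id {K : Set (EuclideanSpace ℝ (Fin n))} (hne : K.Nonempty) {σ : ℝ}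
    (hσ : 0 ≤ σ) : worstCaseRate K σ (fun y => y) = ENNReal.ofReal (√n * σ) := by
  simp_rw [worstCaseRate, risk_id]
  rw [biSup_const hne, ENNReal.ofReal_rpow_of_nonneg (by positivity) (by norm_num),
    ← Real.sqrt_eq_rpow, Real.sqrt_mul (Nat.cast_nonneg n), Real.sqrt_sq hσ]

end SequenceModel

theorem corollary2p11 :
    ∃ A : ℝ, 0 < A ∧ ∃ c₀ : ℝ, 1 < c₀ ∧ ∀ c : ℝ, c₀ ≤ c → ∃ C₀ : ℝ, 1 < C₀ ∧ ∀ C : ℝ, C₀ ≤ C →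
      ∀ n : ℕ, 1 ≤ n → ∀ σ : ℝ, 0 < σ → ∀ K : Set (EuclideanSpace ℝ (Fin n)),
        K.Nonempty → IsClosed K → Convex ℝ K →
          SequenceModel.worstCaseRate K σ (SequenceModel.lse K) ≤
            ENNReal.ofReal (A * (√σ * SequenceModel.logFactor C c n *
              (√(SequenceModel.minimaxRate K c σ) * (n : ℝ) ^ (1 / 4 : ℝ)))) ∧
          SequenceModel.worstCaseRate K σ (fun y => y) = ENNReal.ofReal (√n * σ) ∧
          SequenceModel.worstCaseRate K σ (SequenceModel.lse K) ≤
            ENNReal.ofReal (A * SequenceModel.logFactor C c n *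
              √(SequenceModel.minimaxRate K c σ * (√n * σ))) := by
  -- `c₀ = 2` is what the nets require, and `C₀ = 10` gives C_n ≥ 4C ≥ 40 = √1600, so `A = 1` works.
  refine ⟨1, one_pos, 2, one_lt_two, fun c hc => ⟨10, by norm_num,
    fun C hC n hn σ hσ K hne hcl hconv => ?_⟩⟩
  have he := SequenceModel.minimaxRate_nonneg K c σ
  have hmain : SequenceModel.worstCaseRate K σ (SequenceModel.lse K) ≤
      ENNReal.ofReal (1 * SequenceModel.logFactor C c n *
        √(SequenceModel.minimaxRate K c σ * (√n * σ))) := by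
    refine (SequenceModel.worstCaseRate_le_ofReal (by positivity) fun μ hμ =>
      SequenceModel.risk_lse_le hcl hconv hn hc hσ hμ).trans (ENNReal.ofReal_le_ofReal ?_)
    have h40 : √(1600 : ℝ) = 40 := by
      rw [show (1600 : ℝ) = 40 ^ 2 by norm_num, Real.sqrt_sq (by norm_num)]
    rw [Real.sqrt_mul (by norm_num), h40, one_mul]
    gcongr
    linarith [SequenceModel.four_mul_le_logFactor (C := C) (c := c) (by linarith) (by linarith) hn]
  refine ⟨hmain.trans_eq (congrArg ENNReal.ofReal ?_), SequenceModel.worstCaseRate_id hne hσ.le,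
    hmain⟩
  have hroot : √(√(n : ℝ)) = (n : ℝ) ^ (1 / 4 : ℝ) := by
    rw [Real.sqrt_eq_rpow, Real.sqrt_eq_rpow, ← Real.rpow_mul (Nat.cast_nonneg n)]
    norm_num
  rw [Real.sqrt_mul he, Real.sqrt_mul (Real.sqrt_nonneg _), hroot]
  ring
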